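/- Let $(a,b)\subset\mathbb{R}$ be a finite interval, $n\in\mathbb{N}\cup\{0\}$, $m,r,l\in\mathbb{N}$, $1\le p\le\infty$. Let $W_p^k=W_p^k([a,b];\mathbb{C})$ be the Sobolev space with the norm $\|y\|_{k,p}=\sum_{j=0}^{k}\|y^{(j)}\|_p$: $W_p^0=L_p$ and, for $k\ge 1$, $W_p^k=\{y\in C^{k-1}[a,b]: y^{(k-1)}\in AC[a,b],\ y^{(k)}\in L_p\}$; vector-valued and matrix-valued functions are of class $W_p^k$ if all their entries are. Let $A_0,\dots,A_{r-1}\in (W_p^n)^{m\times m}$, put $$Ly:=y^{(r)}+\sum_{j=1}^{r}A_{r-j}\,y^{(r-j)}\in (W_p^n)^m\qquad\text{for } y\in (W_p^{n+r})^m,$$ and let $B\colon (W_p^{n+r})^m\to\mathbb{C}^l$ be any continuous linear operator. Consider the operator $$(L,B)\colon (W_p^{n+r})^m\to (W_p^n)^m\times\mathbb{C}^l,\qquad y\mapsto (Ly,By).$$ For each $i\in\{1,\dots,r\}$ the matrix Cauchy problem $$Y_i^{(r)}+\sum_{j=1}^{r}A_{r-j}\,Y_i^{(r-j)}=O_m \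 \text{ on } (a,b)\ (\text{almost everywhere if } n=0),\qquad Y_i^{(j-1)}(a)=\delta_{ij}I_m,\quad j=1,\dots,r,$$ has a unique solution $Y_i\in (W_p^{n+r})^{m\times m}$. Let $[BY_i]\in\mathbb{C}^{l\times m}$ be the matrix whose $j$-th column is the value of $B$ at the $j$-th column of $Y_i$, and let $$M(L,B):=\big([BY_1],\dots,[BY_r]\big)\in\mathbb{C}^{l\times rm}$$ be the characteristic matrix, regarded as a linear map $\mathbb{C}^{rm}\to\mathbb{C}^l$. Then $$\dim\ker(L,B)=\dim\ker M(L,B),\qquad \dim\operatorname{coker}(L,B)=\dim\operatorname{coker}M(L,B),$$ where $\operatorname{coker}T$ is the quotient of the target space of $T$ by the range of $T$. -/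

import Mathlib

open MeasureTheory Set Filter

noncomputable section

/-- Lebesgue measure on the interval `[a, b]`. -/
abbrev intervalMeasure (a b : ℝ) : Measure ℝ := volume.restrict (Icc a b)

/-- The function `y` represents an element of `W_p^k([a,b]; ℂ)`. For `k = 0` this is `L_p`; for
`k + 1` it says that `y` is `C^k` on `[a, b]` (one-sided derivatives at the ends), that `y^{(k)}`
is absolutely continuous on `[a, b]` (so `y^{(k+1)}` exists almost everywhere), and that
`y^{(k+1)}` belongs to `L_p`. Only the values on `[a, b]` matter. -/
def MemSobolev (p : ENNReal) (a b : ℝ) : ℕ → (ℝ → ℂ) → Prop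
  | 0, y => MemLp y p (intervalMeasure a b)
  | k + 1, y => ContDiffOn ℝ k y (Icc a b) ∧
      AbsolutelyContinuousOnInterval (iteratedDerivWithin k y (Icc a b)) a b ∧
      MemLp (iteratedDerivWithin (k + 1) y (Icc a b)) p (intervalMeasure a b)

namespace MemSobolev

variable {p : ENNReal} {a b : ℝ} {k : ℕ} {y z : ℝ → ℂ}

theorem ae_diff (hab : a < b) (h : AbsolutelyContinuousOnInterval y a b) :
    ∀ᵐ t ∂(intervalMeasure a b), DifferentiableWithinAt ℝ y (Icc a b) t := by
  rw [ae_restrict_iff' measurableSet_Icc]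
  have := h.boundedVariationOn.locallyBoundedVariationOn.ae_differentiableWithinAt_of_mem
  rwa [uIcc_of_le hab.le] at this

theorem ae_mem : ∀ᵐ t ∂(intervalMeasure a b), t ∈ Icc a b :=
  ae_restrict_mem measurableSet_Icc

theorem ae_of_eqOn {f g : ℝ → ℂ} (h : EqOn f g (Icc a b)) : f =ᵐ[intervalMeasure a b] g := by
  filter_upwards [ae_mem] with t ht using h ht

theorem ac_congr {f g : ℝ → ℂ} (hab : a < b) (hf : AbsolutelyContinuousOnInterval f a b)
    (h : EqOn f g (Icc a b)) : AbsolutelyContinuousOnInterval g a b := by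
  rw [absolutelyContinuousOnInterval_iff] at hf ⊢
  intro ε hε
  obtain ⟨δ, hδ, H⟩ := hf ε hε
  refine ⟨δ, hδ, fun E hE hl => ?_⟩
  convert H E hE hl using 1
  refine Finset.sum_congr rfl fun i hi => ?_
  have h1 := hE.1 i hi
  rw [uIcc_of_le hab.le] at h1
  rw [h h1.1, h h1.2]

theorem congr (hab : a < b) (hy : MemSobolev p a b k y) (h : EqOn y z (Icc a b)) :
    MemSobolev p a b k z := by
  cases k with
  | zero => exact (memLp_congr_ae (ae_of_eqOn h)).1 hy
  | succ k =>
    obtain ⟨h1, h2, h3⟩ := hy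
    exact ⟨h1.congr fun t ht => (h ht).symm, ac_congr hab h2 (iteratedDerivWithin_congr h),
      (memLp_congr_ae (ae_of_eqOn (iteratedDerivWithin_congr h))).1 h3⟩

theorem zero : MemSobolev p a b k (0 : ℝ → ℂ) := by
  have h0 : ∀ j, iteratedDerivWithin j (0 : ℝ → ℂ) (Icc a b) = 0 := fun j => by
    ext t; simp [iteratedDerivWithin_const_zero]
  cases k with
  | zero => exact MemLp.zero
  | succ k =>
    refine ⟨contDiffOn_const, ?_, ?_⟩
    · rw [h0]
      exact ((contDiff_const (c := (0 : ℂ))).contDiffOn (s := uIcc a b) (n := 1)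
        (𝕜 := ℝ)).absolutelyContinuousOnInterval
    · rw [h0]; exact MemLp.zero

theorem iteratedDeriv_linear (hab : a < b) (hy : MemSobolev p a b k y)
    (hz : MemSobolev p a b k z) (c : ℂ) {j : ℕ} (hj : j ≤ k) :
    iteratedDerivWithin j (y + c • z) (Icc a b) =ᵐ[intervalMeasure a b]
      iteratedDerivWithin j y (Icc a b) + c • iteratedDerivWithin j z (Icc a b) := by
  have hU := uniqueDiffOn_Icc hab
  have key : ∀ i : ℕ, ContDiffOn ℝ i y (Icc a b) → ContDiffOn ℝ i z (Icc a b) →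
      EqOn (iteratedDerivWithin i (y + c • z) (Icc a b))
        (iteratedDerivWithin i y (Icc a b) + c • iteratedDerivWithin i z (Icc a b))
        (Icc a b) := by
    intro i h1 h2 t ht
    have h2c : ContDiffOn ℝ i (c • z) (Icc a b) := h2.const_smul c
    rw [iteratedDerivWithin_add ht hU (h1 t ht) (h2c t ht),
      iteratedDerivWithin_const_smul ht hU c (h2 t ht)]
    rfl
  cases k with
  | zero =>
    obtain rfl : j = 0 := by omega
    simp
  | succ k =>
    obtain ⟨h1, h2, -⟩ := hy
    obtain ⟨g1, g2, -⟩ := hz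
    rcases Nat.lt_or_ge k j with h | h
    · obtain rfl : j = k + 1 := by omega
      filter_upwards [ae_mem, ae_diff hab h2, ae_diff hab g2] with t ht d1 d2
      rw [iteratedDerivWithin_succ, derivWithin_congr (key k h1 g1) (key k h1 g1 ht),
        derivWithin_add d1 (d2.const_smul c), derivWithin_const_smul c d2]
      simp [iteratedDerivWithin_succ]
    · have hjk : ((j : ℕ) : WithTop ℕ∞) ≤ (k : WithTop ℕ∞) := by exact_mod_cast h
      exact ae_of_eqOn (key j (h1.of_le hjk) (g1.of_le hjk))

theorem add_smul (hab : a < b) (hy : MemSobolev p a b k y) (hz : MemSobolev p a b k z) (c : ℂ) :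
    MemSobolev p a b k (y + c • z) := by
  have hU := uniqueDiffOn_Icc hab
  cases k with
  | zero => exact MemLp.add hy (MemLp.const_smul hz c)
  | succ k =>
    have hl := iteratedDeriv_linear hab hy hz c le_rfl
    obtain ⟨h1, h2, h3⟩ := hy
    obtain ⟨g1, g2, g3⟩ := hz
    have g1c : ContDiffOn ℝ k (c • z) (Icc a b) := g1.const_smul c
    refine ⟨h1.add g1c, ?_, (memLp_congr_ae hl).2 (h3.add (g3.const_smul c))⟩
    refine ac_congr hab (h2.add (g2.const_smul c)) fun t ht => ?_
    rw [iteratedDerivWithin_add ht hU (h1 t ht) (g1c t ht),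
      iteratedDerivWithin_const_smul ht hU c (g1 t ht)]
    rfl

theorem succ_succ_iff (hab : a < b) : MemSobolev p a b (k + 2) y ↔
    DifferentiableOn ℝ y (Icc a b) ∧
      MemSobolev p a b (k + 1) (derivWithin y (Icc a b)) := by
  have hU := uniqueDiffOn_Icc hab
  have h := contDiffOn_succ_iff_derivWithin (𝕜 := ℝ) (n := k) (f := y) hU
  have hc : ((k + 1 : ℕ) : WithTop ℕ∞) = (k : WithTop ℕ∞) + 1 := by push_cast; rfl
  simp only [MemSobolev, hc, h, iteratedDerivWithin_succ' (n := k + 1),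
    iteratedDerivWithin_succ' (n := k)]
  simp [and_assoc]

theorem deriv_succ (hab : a < b) (hy : MemSobolev p a b (k + 1) y) :
    MemSobolev p a b k (derivWithin y (Icc a b)) := by
  cases k with
  | zero => simpa [MemSobolev, iteratedDerivWithin_succ] using hy.2.2
  | succ k => exact ((succ_succ_iff hab).1 hy).2

theorem continuousOn (hab : a < b) (hy : MemSobolev p a b (k + 1) y) :
    ContinuousOn y (Icc a b) := by
  cases k with
  | zero =>
    have h := hy.2.1.continuousOn
    rw [uIcc_of_le hab.le] at h
    simpa using h
  | succ k => exact ((succ_succ_iff hab).1 hy).1.continuousOn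

theorem memLp_of_continuousOn {f : ℝ → ℂ} (hf : ContinuousOn f (Icc a b)) :
    MemLp f p (intervalMeasure a b) := by
  obtain ⟨C, hC⟩ := isCompact_Icc.exists_bound_of_continuousOn hf
  refine MemLp.of_bound (hf.aestronglyMeasurable measurableSet_Icc) C ?_
  filter_upwards [ae_mem] with t ht using hC t ht

theorem pred (hab : a < b) (hy : MemSobolev p a b (k + 1) y) : MemSobolev p a b k y := by
  induction k generalizing y with
  | zero => exact memLp_of_continuousOn (hy.continuousOn hab)
  | succ k ih =>
    cases k with
    | zero =>
      have h0 := (succ_succ_iff hab).1 hy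
      have hc := h0.2.continuousOn hab
      refine ⟨contDiffOn_zero.2 h0.1.continuousOn, ?_, ?_⟩
      · have : ContDiffOn ℝ 1 y (uIcc a b) := by
          rw [uIcc_of_le hab.le]; simpa using hy.1
        simpa using this.absolutelyContinuousOnInterval
      · simpa [iteratedDerivWithin_succ] using memLp_of_continuousOn hc
    | succ k =>
      have h0 := (succ_succ_iff hab).1 hy
      exact (succ_succ_iff hab).2 ⟨h0.1, ih h0.2⟩

theorem mono (hab : a < b) {i : ℕ} (hy : MemSobolev p a b k y) (hi : i ≤ k) :
    MemSobolev p a b i y := by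
  induction hi using Nat.decreasingInduction with
  | self => exact hy
  | of_succ j _ ih => exact ih.pred hab

theorem iteratedDeriv (hab : a < b) {i j : ℕ} (hy : MemSobolev p a b k y) (h : i + j ≤ k) :
    MemSobolev p a b i (iteratedDerivWithin j y (Icc a b)) := by
  induction j generalizing i with
  | zero => simpa using hy.mono hab h
  | succ j ih =>
    rw [iteratedDerivWithin_succ]
    exact (ih (i := i + 1) (by omega)).deriv_succ hab

/-- `W_p^k` is closed under multiplication by elements of `W_p^{k+1}`. -/
theorem mul (hab : a < b) (hy : MemSobolev p a b k y) (hz : MemSobolev p a b (k + 1) z) :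
    MemSobolev p a b k (y * z) := by
  have hU := uniqueDiffOn_Icc hab
  induction k generalizing y z with
  | zero =>
    have hz' : MemLp z ⊤ (intervalMeasure a b) := memLp_of_continuousOn (hz.continuousOn hab)
    exact MemLp.mul (p := p) (q := ⊤) (r := p) hz' hy
  | succ k ih =>
    have A := ih (hy.deriv_succ hab) (hz.pred hab)
    have B' : MemSobolev p a b k (derivWithin z (Icc a b) * y) :=
      ih ((hz.deriv_succ hab).pred hab) hy
    have S : MemSobolev p a b k
        (derivWithin y (Icc a b) * z + (1 : ℂ) • (derivWithin z (Icc a b) * y)) :=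
      A.add_smul hab B' 1
    have hzd := ((succ_succ_iff hab).1 hz).1
    cases k with
    | zero =>
      have hyc := hy.continuousOn hab
      have hyac : AbsolutelyContinuousOnInterval y a b := by simpa using hy.2.1
      have hzac : AbsolutelyContinuousOnInterval z a b := by
        simpa using (hz.pred hab).2.1
      refine ⟨contDiffOn_zero.2 (hyc.mul hzd.continuousOn), ?_, ?_⟩
      · simpa using hyac.smul hzac
      · refine (memLp_congr_ae ?_).2 S
        filter_upwards [ae_mem, ae_diff hab hyac] with t ht d
        rw [zero_add, iteratedDerivWithin_one, derivWithin_mul d (hzd t ht)]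
        simp; ring
    | succ k =>
      have hyd := ((succ_succ_iff hab).1 hy).1
      refine (succ_succ_iff hab).2 ⟨hyd.mul hzd, S.congr hab fun t ht => ?_⟩
      rw [derivWithin_mul (hyd t ht) (hzd t ht)]
      simp; ring

/-- Representatives of one class have almost everywhere equal derivatives. -/
theorem iteratedDeriv_congr_ae (hab : a < b) (hy : MemSobolev p a b k y)
    (hz : MemSobolev p a b k z) (h : y =ᵐ[intervalMeasure a b] z) {j : ℕ} (hj : j ≤ k) :
    iteratedDerivWithin j y (Icc a b) =ᵐ[intervalMeasure a b]
      iteratedDerivWithin j z (Icc a b) := by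
  cases k with
  | zero =>
    obtain rfl : j = 0 := by omega
    simpa using h
  | succ k =>
    have : EqOn y z (Icc a b) :=
      Measure.eqOn_Icc_of_ae_eq volume hab.ne h (hy.continuousOn hab) (hz.continuousOn hab)
    exact ae_of_eqOn (iteratedDerivWithin_congr this)

end MemSobolev

section SobolevSpace

variable (p : ENNReal) (a b : ℝ) [hab : Fact (a < b)]

/-- `W_p^k([a,b]; ℂ)` as a subspace of `L_p`: the classes which have a representative as in
`MemSobolev`. For `k ≥ 1` this representative is unique on `[a, b]`, by continuity. -/
def sobolevSubmodule (k : ℕ) : Submodule ℂ (Lp ℂ p (intervalMeasure a b)) where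
  carrier := {f | ∃ y : ℝ → ℂ, MemSobolev p a b k y ∧ f =ᵐ[intervalMeasure a b] y}
  zero_mem' := ⟨0, MemSobolev.zero, Lp.coeFn_zero _ _ _⟩
  add_mem' := by
    rintro f g ⟨y, hy, hfy⟩ ⟨z, hz, hgz⟩
    refine ⟨y + (1 : ℂ) • z, hy.add_smul hab.out hz 1, ?_⟩
    filter_upwards [Lp.coeFn_add f g, hfy, hgz] with t h1 h2 h3
    rw [h1]
    simp [h2, h3]
  smul_mem' := by
    rintro c f ⟨y, hy, hfy⟩
    refine ⟨0 + c • y, MemSobolev.zero.add_smul hab.out hy c, ?_⟩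
    filter_upwards [Lp.coeFn_smul c f, hfy] with t h1 h2
    simp [h1, h2]

/-- The Sobolev space `W_p^k([a,b]; ℂ)`. Its norm is defined below; it is not the `L_p` norm. -/
def Sobolev (k : ℕ) : Type := sobolevSubmodule p a b k

instance (k : ℕ) : AddCommGroup (Sobolev p a b k) :=
  inferInstanceAs (AddCommGroup (sobolevSubmodule p a b k))

instance (k : ℕ) : Module ℂ (Sobolev p a b k) :=
  inferInstanceAs (Module ℂ (sobolevSubmodule p a b k))

namespace Sobolev

variable {p a b} {k : ℕ}

/-- The `L_p` class of an element of `W_p^k`. -/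
def toLp : Sobolev p a b k →ₗ[ℂ] Lp ℂ p (intervalMeasure a b) :=
  (sobolevSubmodule p a b k).subtype

/-- A representative as in `MemSobolev`, unique on `[a, b]` if `k ≥ 1`. -/
def rep (f : Sobolev p a b k) : ℝ → ℂ := f.2.choose

theorem rep_mem (f : Sobolev p a b k) : MemSobolev p a b k f.rep := f.2.choose_spec.1

theorem toLp_ae (f : Sobolev p a b k) : toLp f =ᵐ[intervalMeasure a b] f.rep :=
  f.2.choose_spec.2

theorem toLp_injective : Function.Injective (toLp : Sobolev p a b k →ₗ[ℂ] _) :=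
  Subtype.val_injective

theorem ext_rep {f g : Sobolev p a b k} (h : f.rep =ᵐ[intervalMeasure a b] g.rep) : f = g :=
  toLp_injective (Lp.ext ((toLp_ae f).trans (h.trans (toLp_ae g).symm)))

/-- The element of `W_p^k` with a given representative. -/
def ofFun (y : ℝ → ℂ) (hy : MemSobolev p a b k y) : Sobolev p a b k :=
  ⟨MemLp.toLp y (hy.mono hab.out (Nat.zero_le k)), y, hy, MemLp.coeFn_toLp _⟩

theorem rep_ofFun (y : ℝ → ℂ) (hy : MemSobolev p a b k y) :
    (ofFun y hy).rep =ᵐ[intervalMeasure a b] y :=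
  (toLp_ae (ofFun y hy)).symm.trans (MemLp.coeFn_toLp (hy.mono hab.out (Nat.zero_le k)))

theorem rep_add (f g : Sobolev p a b k) :
    (f + g).rep =ᵐ[intervalMeasure a b] f.rep + (1 : ℂ) • g.rep := by
  have h : toLp (f + g) =ᵐ[intervalMeasure a b] toLp f + toLp g := by
    rw [map_add]; exact Lp.coeFn_add _ _
  filter_upwards [toLp_ae f, toLp_ae g, toLp_ae (f + g), h] with t h1 h2 h3 h4
  simp_all

theorem rep_smul (c : ℂ) (f : Sobolev p a b k) :
    (c • f).rep =ᵐ[intervalMeasure a b] 0 + c • f.rep := by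
  have h : toLp (c • f) =ᵐ[intervalMeasure a b] c • toLp f := by
    rw [map_smul]; exact Lp.coeFn_smul _ _
  filter_upwards [toLp_ae f, toLp_ae (c • f), h] with t h1 h3 h4
  simp_all

/-- Differentiation `y ↦ y^{(j)}` as an operator `W_p^k → W_p^i`, where `i + j ≤ k`. -/
def deriv (i j : ℕ) (h : i + j ≤ k) : Sobolev p a b k →ₗ[ℂ] Sobolev p a b i where
  toFun f := ofFun (iteratedDerivWithin j f.rep (Icc a b)) (f.rep_mem.iteratedDeriv hab.out h)
  map_add' f g := by
    refine ext_rep ((rep_ofFun _ _).trans ?_)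
    have h1 := MemSobolev.iteratedDeriv_congr_ae hab.out (f + g).rep_mem
      (f.rep_mem.add_smul hab.out g.rep_mem 1) (rep_add f g) (j := j) (by omega)
    have h2 := MemSobolev.iteratedDeriv_linear hab.out f.rep_mem g.rep_mem 1 (j := j) (by omega)
    refine h1.trans (h2.trans (EventuallyEq.symm ((rep_add _ _).trans ?_)))
    exact (rep_ofFun _ _).add ((rep_ofFun _ _).const_smul 1)
  map_smul' c f := by
    refine ext_rep ((rep_ofFun _ _).trans ?_)
    have h1 := MemSobolev.iteratedDeriv_congr_ae hab.out (c • f).rep_mem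
      (MemSobolev.zero.add_smul hab.out f.rep_mem c) (rep_smul c f) (j := j) (by omega)
    have h2 := MemSobolev.iteratedDeriv_linear hab.out (MemSobolev.zero (k := k)) f.rep_mem c
      (j := j) (by omega)
    have h0 : iteratedDerivWithin j (0 : ℝ → ℂ) (Icc a b) = 0 := by
      ext t; simp [iteratedDerivWithin_const_zero]
    rw [h0] at h2
    refine h1.trans (h2.trans (EventuallyEq.symm ((rep_smul _ _).trans ?_)))
    exact Filter.EventuallyEq.rfl.add ((rep_ofFun _ _).const_smul c)

/-- The value `y^{(j)}(t)`, which is meaningful for every `t ∈ [a, b]` if `j < k`. -/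
def derivAt (f : Sobolev p a b k) (j : ℕ) (t : ℝ) : ℂ := iteratedDerivWithin j f.rep (Icc a b) t

/-- Multiplication `y ↦ f y` by an element `f` of `W_p^k`, as an operator `W_p^{k+1} → W_p^k`. -/
def mulLeft (f : Sobolev p a b k) : Sobolev p a b (k + 1) →ₗ[ℂ] Sobolev p a b k where
  toFun g := ofFun (f.rep * g.rep) (f.rep_mem.mul hab.out g.rep_mem)
  map_add' g h := by
    refine ext_rep ((rep_ofFun _ _).trans (EventuallyEq.symm ((rep_add _ _).trans ?_)))
    filter_upwards [rep_ofFun _ (f.rep_mem.mul hab.out g.rep_mem),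
      rep_ofFun _ (f.rep_mem.mul hab.out h.rep_mem), rep_add g h] with t h1 h2 h3
    simp [h1, h2, h3, mul_add]
  map_smul' c g := by
    refine ext_rep ((rep_ofFun _ _).trans (EventuallyEq.symm ((rep_smul _ _).trans ?_)))
    filter_upwards [rep_ofFun _ (f.rep_mem.mul hab.out g.rep_mem), rep_smul c g] with t h1 h2
    simp [h1, h2, mul_left_comm]

/-- The norm `‖y‖_{k,p} = ∑_{j ≤ k} ‖y^{(j)}‖_p`. -/
instance [Fact (1 ≤ p)] : NormedAddCommGroup (Sobolev p a b k) :=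
  AddGroupNorm.toNormedAddCommGroup
    { toFun := fun f => ∑ j : Fin (k + 1), ‖toLp (deriv 0 j.1 (by omega) f)‖
      map_zero' := by simp
      add_le' := fun f g => by
        rw [← Finset.sum_add_distrib]
        refine Finset.sum_le_sum fun j _ => ?_
        rw [map_add, map_add]
        exact norm_add_le _ _
      neg' := fun f => by simp
      eq_zero_of_map_eq_zero' := fun f hf => by
        rw [Finset.sum_eq_zero_iff_of_nonneg fun _ _ => norm_nonneg _] at hf
        have h0 := norm_eq_zero.1 (hf 0 (Finset.mem_univ _))
        refine toLp_injective (Lp.ext ?_)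
        rw [map_zero, ← h0]
        refine (toLp_ae f).trans (EventuallyEq.symm ((toLp_ae _).trans ?_))
        refine (rep_ofFun (iteratedDerivWithin 0 f.rep (Icc a b))
          (f.rep_mem.iteratedDeriv hab.out (by omega))).trans ?_
        simp }

theorem norm_def [Fact (1 ≤ p)] (f : Sobolev p a b k) :
    ‖f‖ = ∑ j : Fin (k + 1), ‖toLp (deriv 0 j.1 (by omega) f)‖ := rfl

instance [Fact (1 ≤ p)] : NormedSpace ℂ (Sobolev p a b k) where
  norm_smul_le c f := by
    simp [norm_def, norm_smul, Finset.mul_sum]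

end Sobolev

section BoundaryValueProblem

variable {p a b} {n m r l : ℕ}

/-- The differential operator `L y = y^{(r)} + ∑_{s < r} A_s y^{(s)}`, which maps
`(W_p^{n+r})^m` to `(W_p^n)^m`; the entries of the matrices `A_s` belong to `W_p^n`. -/
def diffOp (A : Fin r → Matrix (Fin m) (Fin m) (Sobolev p a b n)) :
    (Fin m → Sobolev p a b (n + r)) →ₗ[ℂ] (Fin m → Sobolev p a b n) :=
  LinearMap.pi fun u =>
    Sobolev.deriv n r le_rfl ∘ₗ LinearMap.proj u +
      ∑ s : Fin r, ∑ w : Fin m,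
        Sobolev.mulLeft (A s u w) ∘ₗ Sobolev.deriv (n + 1) s.1 (by omega) ∘ₗ LinearMap.proj w

/-- The operator `(L, B) : (W_p^{n+r})^m → (W_p^n)^m × ℂ^l` of the boundary-value problem. -/
def bvpOp [Fact (1 ≤ p)] (A : Fin r → Matrix (Fin m) (Fin m) (Sobolev p a b n))
    (B : (Fin m → Sobolev p a b (n + r)) →L[ℂ] (Fin l → ℂ)) :
    (Fin m → Sobolev p a b (n + r)) →ₗ[ℂ] (Fin m → Sobolev p a b n) × (Fin l → ℂ) :=
  (diffOp A).prod B.toLinearMap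

/-- `Y` solves the `i`-th matrix Cauchy problem: `Y^{(r)} + ∑_{s < r} A_s Y^{(s)} = 0` (stated
column by column) and `Y^{(j)}(a) = δ_{ij} I_m` for `0 ≤ j < r`, where `i` counts from `0`. -/
def IsCauchySolution (A : Fin r → Matrix (Fin m) (Fin m) (Sobolev p a b n)) (i : Fin r)
    (Y : Matrix (Fin m) (Fin m) (Sobolev p a b (n + r))) : Prop :=
  (∀ v : Fin m, diffOp A (fun u => Y u v) = 0) ∧
    ∀ j : Fin r, Y.map (fun y => y.derivAt j.1 a) = if i = j then 1 else 0

/-- The block matrix `([BY_1], …, [BY_r])`, of size `l × rm`; its column `(i, v)` is the value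
of `B` at the column `v` of `Y i`. -/
def charMatrix [Fact (1 ≤ p)] (B : (Fin m → Sobolev p a b (n + r)) →L[ℂ] (Fin l → ℂ))
    (Y : Fin r → Matrix (Fin m) (Fin m) (Sobolev p a b (n + r))) :
    Matrix (Fin l) (Fin r × Fin m) ℂ :=
  Matrix.of fun c iv => B (fun u => Y iv.1 u iv.2) c

end BoundaryValueProblem

end SobolevSpace

end

/-! A solution of a linear equation of order `r` is determined by its initial values at `a`, and
both these values and the right-hand side may be prescribed freely. Hence `L` is surjective, and the
map Φ sending d in `ℂ^{rm}` to the homogeneous solution `∑ Y_i d_i` is an isomorphism onto `ker L`,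
inverted by taking initial values. By linearity of `B`, the matrix `M(L,B)` is `B ∘ Φ`, that is, `B`
restricted to `ker L` in these coordinates (`mulVecLin_charMatrix`).

The rest is algebra. The kernel of `(L,B)` is `ker L ∩ ker B`, which Φ identifies with `ker (B ∘ Φ)`
(`rank_ker_prod_eq`). As `L` is surjective, every class modulo the range of `(L,B)` contains some
`(0,w)`, and `(0,w)` lies in the range exactly when w is in `B(ker L)` (`rank_coker_prod_eq`).

The analytic content is the Cauchy problem with coefficients that may be merely `L_p`. It is
rewritten as a Volterra system for `(y, …, y^{(r-1)})`, solved by a contraction in an exponentially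
weighted sup norm (`exists_contracting_volterra`). The continuous solution is then bootstrapped to
order `n + r` (`exists_solution_cauchy`). Uniqueness comes from the same contraction
(`solution_cauchy_eq_zero`). -/

/-! ### Absolute continuity and the fundamental theorem of calculus for complex-valued functions. -/

namespace AbsolutelyContinuousOnInterval

theorem ofReal {F : ℝ → ℝ} {a b : ℝ} (hF : AbsolutelyContinuousOnInterval F a b) :
    AbsolutelyContinuousOnInterval (fun t => (F t : ℂ)) a b := by
  rw [absolutelyContinuousOnInterval_iff] at hF ⊢
  simpa only [Complex.isometry_ofReal.dist_eq] using hF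

/-- The real and imaginary parts are primitives of integrable real functions; they are recombined on
`[a, b]`. -/
theorem integral_complex {f : ℝ → ℂ} {a b : ℝ} (hf : IntervalIntegrable f volume a b) :
    AbsolutelyContinuousOnInterval (fun t => ∫ s in a..t, f s) a b := by
  have hre : IntervalIntegrable (fun s => (f s).re) volume a b := ⟨hf.1.re, hf.2.re⟩
  have him : IntervalIntegrable (fun s => (f s).im) volume a b := ⟨hf.1.im, hf.2.im⟩
  have h1 := (hre.absolutelyContinuousOnInterval_intervalIntegral left_mem_uIcc).ofReal
  have h2 := (him.absolutelyContinuousOnInterval_intervalIntegral left_mem_uIcc).ofReal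
  have h := h1.add (h2.const_smul Complex.I)
  rw [absolutelyContinuousOnInterval_iff] at h ⊢
  intro ε hε
  obtain ⟨δ, hδ, H⟩ := h ε hε
  have key : ∀ t ∈ uIcc a b, ∫ s in a..t, f s =
      ((∫ s in a..t, (f s).re : ℝ) : ℂ) + Complex.I • ((∫ s in a..t, (f s).im : ℝ) : ℂ) := by
    intro t ht
    have hs : uIcc a t ⊆ uIcc a b := uIcc_subset_uIcc left_mem_uIcc ht
    rw [← intervalIntegral.integral_ofReal, ← intervalIntegral.integral_ofReal,
      ← intervalIntegral.integral_smul, ← intervalIntegral.integral_add]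
    · refine intervalIntegral.integral_congr fun s _ => ?_
      simpa [mul_comm] using (Complex.re_add_im (f s)).symm
    · have := hre.mono_set hs
      exact ⟨this.1.ofReal, this.2.ofReal⟩
    · have := him.mono_set hs
      exact IntervalIntegrable.smul (f := fun s => ((f s).im : ℂ))
        ⟨this.1.ofReal, this.2.ofReal⟩ Complex.I
  refine ⟨δ, hδ, fun E hE hl => ?_⟩
  convert H E hE hl using 1
  refine Finset.sum_congr rfl fun i hi => ?_
  have h1 := hE.1 i hi
  simp only [key _ h1.1, key _ h1.2, Pi.add_apply]

end AbsolutelyContinuousOnInterval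

theorem ae_hasDerivAt_of_derivWithin {a b : ℝ} {y : ℝ → ℂ}
    (hab : a < b) (hy : AbsolutelyContinuousOnInterval y a b) :
    ∀ᵐ t ∂(intervalMeasure a b), HasDerivAt y (derivWithin y (Icc a b) t) t := by
  -- Discarding the two endpoints, a null set, turns the one-sided derivative into a genuine one.
  have h0 : ∀ᵐ t ∂(intervalMeasure a b), t ∈ Ioo a b := by
    have : intervalMeasure a b = volume.restrict (Ioo a b) :=
      (Measure.restrict_congr_set Ioo_ae_eq_Icc).symm
    rw [this]
    exact ae_restrict_mem measurableSet_Ioo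
  filter_upwards [MemSobolev.ae_diff hab hy, h0] with t d ht
  exact d.hasDerivWithinAt.hasDerivAt (Icc_mem_nhds ht.1 ht.2)

/-- The difference of `y` and the primitive of `v` is absolutely continuous with derivative zero
almost everywhere, hence constant; its value is read off at `a`. -/
theorem AbsolutelyContinuousOnInterval.eq_add_integral {a b : ℝ} {y v : ℝ → ℂ} (hab : a < b)
    (hy : AbsolutelyContinuousOnInterval y a b) (hv : IntervalIntegrable v volume a b)
    (h : derivWithin y (Icc a b) =ᵐ[intervalMeasure a b] v) {t : ℝ} (ht : t ∈ Icc a b) :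
    y t = y a + ∫ s in a..t, v s := by
  have hac := hy.sub (integral_complex hv)
  obtain ⟨C, hC⟩ := hac.const_of_ae_hasDerivAt_zero (by
    have h1 := (ae_restrict_iff' measurableSet_Icc).1 (ae_hasDerivAt_of_derivWithin hab hy)
    have h2 := (ae_restrict_iff' measurableSet_Icc).1 h
    filter_upwards [h1, h2, hv.ae_hasDerivAt_integral] with s h1 h2 h3 hs
    have hs' := hs
    rw [uIcc_of_le hab.le] at hs'
    have := (h1 hs').sub (h3 hs a left_mem_uIcc)
    rwa [h2 hs', sub_self] at this)
  rw [uIcc_of_le hab.le] at hC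
  have e1 := hC t ht
  have e2 := hC a (left_mem_Icc.2 hab.le)
  simp only [Pi.sub_apply, intervalIntegral.integral_same, sub_zero] at e1 e2
  rw [e2, ← e1]; ring

/-! ### Linear Volterra systems with integrable coefficients. -/

/-- Supplies the contraction constant of the weighted norm. Since φ is only integrable, it is split
into a bounded part, whose weighted integral is `O(1/c)`, and a part that is small in `L_1`, where
the weight is bounded by 1. -/
theorem exists_integral_exp_mul_norm_le {a b : ℝ} (hab : a < b) {φ : ℝ → ℝ}
    (hφ : IntervalIntegrable φ volume a b) :
    ∃ c : ℝ, ∀ t ∈ Icc a b, ∫ s in a..t, Real.exp (-c * (t - s)) * |φ s| ≤ 1 / 2 := by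
  have hi : Integrable ((Icc a b).indicator φ) := by
    rw [integrable_indicator_iff measurableSet_Icc]
    exact (intervalIntegrable_iff_integrableOn_Icc_of_le hab.le).1 hφ
  obtain ⟨g, hgs, hg1, hgc, hgi⟩ :=
    hi.exists_hasCompactSupport_integral_sub_le (ε := 1 / 4) (by norm_num)
  obtain ⟨N, hN⟩ := hgs.exists_bound_of_continuous hgc
  have hN0 : 0 ≤ N := (norm_nonneg _).trans (hN 0)
  -- The bounded part contributes at most `N / c`, so `c ≥ 4 * N` makes it at most `1 / 4`; the
  -- summand 1 keeps `c` positive when `N = 0`.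
  refine ⟨4 * N + 1, fun t ht => ?_⟩
  set c := 4 * N + 1 with hc
  have hc0 : 0 < c := by positivity
  have hs : uIcc a t ⊆ uIcc a b :=
    uIcc_subset_uIcc left_mem_uIcc (by rwa [uIcc_of_le hab.le])
  have hce : Continuous fun s => Real.exp (-c * (t - s)) := by fun_prop
  have hdi : Integrable fun s => ‖(Icc a b).indicator φ s - g s‖ := (hi.sub hgi).norm
  have hexp : ∫ s in a..t, Real.exp (-c * (t - s)) = (1 - Real.exp (-c * (t - a))) / c := by
    have hd : ∀ s ∈ uIcc a t, HasDerivAt (fun s => Real.exp (-c * (t - s)) / c)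
        (Real.exp (-c * (t - s))) s := by
      intro s _
      have h1 : HasDerivAt (fun s => -c * (t - s)) c s := by
        simpa using ((hasDerivAt_id s).const_sub t).const_mul (-c)
      have := h1.exp.div_const c
      rwa [mul_div_cancel_right₀ _ hc0.ne'] at this
    rw [intervalIntegral.integral_eq_sub_of_hasDerivAt hd (hce.intervalIntegrable _ _)]
    simp; ring
  calc ∫ s in a..t, Real.exp (-c * (t - s)) * |φ s|
      ≤ ∫ s in a..t, (‖(Icc a b).indicator φ s - g s‖ + N * Real.exp (-c * (t - s))) := by
        refine intervalIntegral.integral_mono_on ht.1 ?_ ?_ fun s hs => ?_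
        · exact ((hφ.mono_set hs).abs).continuousOn_mul hce.continuousOn
        · exact hdi.intervalIntegrable.add ((hce.const_mul N).intervalIntegrable _ _)
        · have hsb : s ∈ Icc a b := ⟨hs.1, hs.2.trans ht.2⟩
          rw [indicator_of_mem hsb]
          have he : Real.exp (-c * (t - s)) ≤ 1 := by
            rw [Real.exp_le_one_iff]
            nlinarith [hs.2]
          have h1 : |φ s| ≤ ‖φ s - g s‖ + N := by
            have := norm_add_le (φ s - g s) (g s)
            rw [sub_add_cancel] at this
            exact this.trans (by linarith [hN s])
          nlinarith [Real.exp_pos (-c * (t - s)), norm_nonneg (φ s - g s)]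
    _ = (∫ s in a..t, ‖(Icc a b).indicator φ s - g s‖)
          + N * ((1 - Real.exp (-c * (t - a))) / c) := by
        rw [intervalIntegral.integral_add hdi.intervalIntegrable
          ((hce.const_mul N).intervalIntegrable _ _), intervalIntegral.integral_const_mul, hexp]
    _ ≤ 1 / 4 + 1 / 4 := by
        refine add_le_add ?_ ?_
        · refine le_trans ?_ hg1
          rw [intervalIntegral.integral_of_le ht.1]
          exact setIntegral_le_integral hdi (Eventually.of_forall fun s => norm_nonneg _)
        · rw [← mul_div_assoc, div_le_iff₀ hc0]
          nlinarith [Real.exp_pos (-c * (t - a))]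
    _ = 1 / 2 := by norm_num

section Volterra

variable {ι : Type*} [Fintype ι] {a b : ℝ} {K : ι → ι → ℝ → ℂ}

theorem intervalIntegrable_sum_mul (hab : a < b)
    (hK : ∀ i j, IntervalIntegrable (K i j) volume a b) {x : ι → ℝ → ℂ}
    (hx : ∀ i, ContinuousOn (x i) (Icc a b)) (i : ι) :
    IntervalIntegrable (fun s => ∑ j, K i j s * x j s) volume a b := by
  have : (fun s => ∑ j, K i j s * x j s) = ∑ j, fun s => K i j s * x j s := by
    ext s; simp
  rw [this]
  refine IntervalIntegrable.sum _ fun j _ => (hK i j).mul_continuousOn ?_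
  rw [uIcc_of_le hab.le]
  exact hx j

/-- After multiplication by a decaying exponential, the Volterra operator of a linear system with
integrable coefficients is a contraction of `C([a, b])`. -/
theorem exists_contracting_volterra (hab : a < b)
    (hK : ∀ i j, IntervalIntegrable (K i j) volume a b) {h : ι → ℝ → ℂ}
    (hh : ∀ i, ContinuousOn (h i) (Icc a b)) :
    ∃ (c : ℝ) (F : C(Icc a b, ι → ℂ) → C(Icc a b, ι → ℂ)), ContractingWith (1 / 2) F ∧
      ∀ w t i, F w t i = (Real.exp (-c * t) : ℂ) * (h i t +
        ∫ s in a..t, ∑ j, K i j s * ((Real.exp (c * s) : ℂ) * IccExtend hab.le w s j)) := by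
  -- The sum over all entries dominates every row sum, so a single `c` serves all components in the
  -- sup norm.
  have hφ : IntervalIntegrable (fun s => ∑ i, ∑ j, ‖K i j s‖) volume a b := by
    have : (fun s => ∑ i, ∑ j, ‖K i j s‖) = ∑ i, ∑ j, fun s => ‖K i j s‖ := by
      ext s; simp
    rw [this]
    exact IntervalIntegrable.sum _ fun i _ => IntervalIntegrable.sum _ fun j _ => (hK i j).norm
  obtain ⟨c, hc⟩ := exists_integral_exp_mul_norm_le hab hφ
  have hw : ∀ (w : C(Icc a b, ι → ℂ)) (j : ι), ContinuousOn
      (fun s => (Real.exp (c * s) : ℂ) * IccExtend hab.le w s j) (Icc a b) := fun w j => by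
    have : Continuous (IccExtend hab.le w) := w.continuous.Icc_extend'
    refine Continuous.continuousOn ?_
    have h2 := (continuous_apply j).comp this
    exact (by fun_prop : Continuous fun s => (Real.exp (c * s) : ℂ)).mul h2
  have hI := fun (w : C(Icc a b, ι → ℂ)) i => intervalIntegrable_sum_mul hab hK (hw w) i
  have hF : ∀ w : C(Icc a b, ι → ℂ), Continuous fun (t : Icc a b) (i : ι) =>
      (Real.exp (-c * t) : ℂ) * (h i t +
        ∫ s in a..t, ∑ j, K i j s * ((Real.exp (c * s) : ℂ) * IccExtend hab.le w s j)) := by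
    intro w
    refine continuous_pi fun i => ?_
    refine (by fun_prop : Continuous fun t : Icc a b => (Real.exp (-c * t) : ℂ)).mul ?_
    have h1 := intervalIntegral.continuousOn_primitive_interval' (hI w i) left_mem_uIcc
    rw [uIcc_of_le hab.le] at h1
    exact (hh i).domRestrict.add h1.domRestrict
  refine ⟨c, fun w => ⟨_, hF w⟩, ⟨by rw [← NNReal.coe_lt_coe]; norm_num,
    LipschitzWith.of_dist_le_mul fun w w' => ?_⟩, fun w t i => rfl⟩
  have hnn : (0 : ℝ) ≤ ((1 / 2 : NNReal) : ℝ) * dist w w' := by positivity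
  refine (ContinuousMap.dist_le hnn).2 fun t => (dist_pi_le_iff hnn).2 fun i => ?_
  have hs : uIcc a (t : ℝ) ⊆ uIcc a b :=
    uIcc_subset_uIcc left_mem_uIcc (by rw [uIcc_of_le hab.le]; exact t.2)
  simp only [ContinuousMap.coe_mk]
  rw [dist_eq_norm, ← mul_sub, add_sub_add_left_eq_sub,
    ← intervalIntegral.integral_sub ((hI w i).mono_set hs) ((hI w' i).mono_set hs),
    ← intervalIntegral.integral_const_mul]
  have hce : Continuous fun s => Real.exp (-c * (t - s)) := by fun_prop
  have hmul : IntervalIntegrable (fun s => Real.exp (-c * (t - s)) * |∑ i, ∑ j, ‖K i j s‖|)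
      volume a t := ((hφ.mono_set hs).abs).continuousOn_mul hce.continuousOn
  calc _ ≤ ∫ s in a..t, Real.exp (-c * (t - s)) * |∑ i, ∑ j, ‖K i j s‖| * dist w w' := by
        refine intervalIntegral.norm_integral_le_of_norm_le t.2.1 ?_ (hmul.mul_const _)
        refine Eventually.of_forall fun s hsm => ?_
        have hsI : s ∈ Icc a b := ⟨hsm.1.le, hsm.2.trans t.2.2⟩
        have h0 : 0 ≤ ∑ i, ∑ j, ‖K i j s‖ :=
          Finset.sum_nonneg fun i _ => Finset.sum_nonneg fun j _ => norm_nonneg _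
        -- The outer factor `e^{-ct}` and the inner `e^{cs}` combine into the weight estimated by
        -- `hc`.
        have hexp : Real.exp (-c * (t - s)) = Real.exp (-c * t) * Real.exp (c * s) := by
          rw [← Real.exp_add]; congr 1; ring
        rw [← Finset.sum_sub_distrib, norm_mul, Complex.norm_real, Real.norm_eq_abs,
          Real.abs_exp, abs_of_nonneg h0, hexp, mul_assoc, mul_assoc]
        refine mul_le_mul_of_nonneg_left ?_ (Real.exp_pos _).le
        refine (norm_sum_le _ _).trans ?_
        calc ∑ j, _ ≤ ∑ j, Real.exp (c * s) * (‖K i j s‖ * dist w w') := by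
              refine Finset.sum_le_sum fun j _ => ?_
              rw [← mul_sub, ← mul_sub, norm_mul, norm_mul, Complex.norm_real, Real.norm_eq_abs,
                Real.abs_exp, mul_left_comm]
              refine mul_le_mul_of_nonneg_left (mul_le_mul_of_nonneg_left ?_ (norm_nonneg _))
                (Real.exp_pos _).le
              rw [IccExtend_of_mem _ _ hsI, IccExtend_of_mem _ _ hsI, ← dist_eq_norm]
              exact (dist_le_pi_dist _ _ j).trans (ContinuousMap.dist_apply_le_dist _)
          _ = Real.exp (c * s) * ((∑ j, ‖K i j s‖) * dist w w') := by
              rw [Finset.sum_mul, Finset.mul_sum]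
          _ ≤ _ := by
              refine mul_le_mul_of_nonneg_left (mul_le_mul_of_nonneg_right ?_ dist_nonneg)
                (Real.exp_pos _).le
              exact Finset.single_le_sum (f := fun i => ∑ j, ‖K i j s‖)
                (fun i _ => Finset.sum_nonneg fun j _ => norm_nonneg _) (Finset.mem_univ i)
    _ = (∫ s in a..t, Real.exp (-c * (t - s)) * |∑ i, ∑ j, ‖K i j s‖|) * dist w w' := by
        rw [intervalIntegral.integral_mul_const]
    _ ≤ _ := by
        refine mul_le_mul_of_nonneg_right ((hc t t.2).trans ?_) dist_nonneg
        norm_num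

theorem exp_neg_mul_exp (c t : ℝ) : (Real.exp (-c * t) : ℂ) * (Real.exp (c * t) : ℂ) = 1 := by
  rw [← Complex.ofReal_mul, ← Real.exp_add]; simp

theorem exists_volterra_solution (hab : a < b)
    (hK : ∀ i j, IntervalIntegrable (K i j) volume a b) {h : ι → ℝ → ℂ}
    (hh : ∀ i, ContinuousOn (h i) (Icc a b)) :
    ∃ x : ι → ℝ → ℂ, (∀ i, ContinuousOn (x i) (Icc a b)) ∧
      ∀ i, ∀ t ∈ Icc a b, x i t = h i t + ∫ s in a..t, ∑ j, K i j s * x j s := by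
  obtain ⟨c, F, hF, he⟩ := exists_contracting_volterra hab hK hh
  obtain ⟨w, hw, -⟩ := hF.exists_fixedPoint 0 (edist_ne_top _ _)
  have hwc : Continuous (IccExtend hab.le w) := w.continuous.Icc_extend'
  -- The fixed point is the solution multiplied by `e^{-cs}`; the weight is undone here.
  refine ⟨fun i s => (Real.exp (c * s) : ℂ) * IccExtend hab.le w s i, fun i => ?_,
    fun i t ht => ?_⟩
  · exact ((by fun_prop : Continuous fun s => (Real.exp (c * s) : ℂ)).mul
      ((continuous_apply i).comp hwc)).continuousOn
  · have h1 := he w ⟨t, ht⟩ i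
    rw [hw] at h1
    simp only
    rw [IccExtend_of_mem _ _ ht, h1, ← mul_assoc, mul_comm (Complex.ofReal (Real.exp (c * t))),
      exp_neg_mul_exp, one_mul]

/-- Every continuous solution, multiplied by `e^{-ct}`, is a fixed point of the same contraction. -/
theorem volterra_solution_unique (hab : a < b)
    (hK : ∀ i j, IntervalIntegrable (K i j) volume a b) {h : ι → ℝ → ℂ} {x y : ι → ℝ → ℂ}
    (hx : ∀ i, ContinuousOn (x i) (Icc a b)) (hy : ∀ i, ContinuousOn (y i) (Icc a b))
    (hh : ∀ i, ContinuousOn (h i) (Icc a b))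
    (hxe : ∀ i, ∀ t ∈ Icc a b, x i t = h i t + ∫ s in a..t, ∑ j, K i j s * x j s)
    (hye : ∀ i, ∀ t ∈ Icc a b, y i t = h i t + ∫ s in a..t, ∑ j, K i j s * y j s) (i : ι) :
    EqOn (x i) (y i) (Icc a b) := by
  obtain ⟨c, F, hF, he⟩ := exists_contracting_volterra hab hK hh
  have key : ∀ z : ι → ℝ → ℂ, (hz : ∀ i, ContinuousOn (z i) (Icc a b)) →
      (∀ i, ∀ t ∈ Icc a b, z i t = h i t + ∫ s in a..t, ∑ j, K i j s * z j s) →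
      ∃ w : C(Icc a b, ι → ℂ), (∀ t i, w t i = (Real.exp (-c * t) : ℂ) * z i t) ∧
        Function.IsFixedPt F w := by
    intro z hz hze
    have hc : Continuous fun (t : Icc a b) (i : ι) => (Real.exp (-c * t) : ℂ) * z i t :=
      continuous_pi fun i => (by fun_prop : Continuous fun t : Icc a b =>
        (Real.exp (-c * t) : ℂ)).mul (hz i).domRestrict
    refine ⟨⟨_, hc⟩, fun t i => rfl, ?_⟩
    ext t i
    rw [he]
    simp only [ContinuousMap.coe_mk]
    rw [hze i t t.2]
    congr 2
    refine intervalIntegral.integral_congr fun s hs => ?_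
    rw [uIcc_of_le t.2.1] at hs
    have hsI : s ∈ Icc a b := ⟨hs.1, hs.2.trans t.2.2⟩
    refine Finset.sum_congr rfl fun j _ => ?_
    rw [IccExtend_of_mem _ _ hsI]
    simp only
    rw [← mul_assoc (Complex.ofReal (Real.exp (c * s))),
      mul_comm (Complex.ofReal (Real.exp (c * s))), exp_neg_mul_exp, one_mul]
  obtain ⟨w, hw, hwF⟩ := key x hx hxe
  obtain ⟨w', hw', hwF'⟩ := key y hy hye
  intro t ht
  have e : w = w' := hF.fixedPoint_unique' hwF hwF'
  have h1 := hw ⟨t, ht⟩ i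
  rw [e, hw'] at h1
  exact (mul_left_cancel₀ (left_ne_zero_of_mul_eq_one (exp_neg_mul_exp c t)) h1).symm

end Volterra

/-! ### Integral representation, primitives and products in Sobolev spaces. -/

namespace MemSobolev

variable {p : ENNReal} {a b : ℝ} {k : ℕ} {y z v : ℝ → ℂ}

theorem intervalIntegrable (hp : 1 ≤ p) (hab : a < b) (hy : MemSobolev p a b k y) :
    IntervalIntegrable y volume a b := by
  have h : MemLp y p (intervalMeasure a b) := hy.mono hab (Nat.zero_le k)
  exact (intervalIntegrable_iff_integrableOn_Icc_of_le hab.le).2 (h.integrable hp)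

theorem absolutelyContinuousOnInterval (hab : a < b) (hy : MemSobolev p a b (k + 1) y) :
    AbsolutelyContinuousOnInterval y a b := by
  simpa using (hy.mono hab (Nat.le_add_left 1 k)).2.1

theorem eq_add_integral (hp : 1 ≤ p) (hab : a < b) (hy : MemSobolev p a b (k + 1) y)
    (hv : derivWithin y (Icc a b) =ᵐ[intervalMeasure a b] v) {t : ℝ} (ht : t ∈ Icc a b) :
    y t = y a + ∫ s in a..t, v s := by
  have h := (hy.deriv_succ hab).intervalIntegrable hp hab
  refine (hy.absolutelyContinuousOnInterval hab).eq_add_integral hab ?_ hv ht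
  rw [intervalIntegrable_iff_integrableOn_Icc_of_le hab.le] at h ⊢
  exact h.congr hv

end MemSobolev

section Primitive

variable {p : ENNReal} {a b : ℝ} {k : ℕ} {y v : ℝ → ℂ} {c : ℂ}

theorem derivWithin_primitive_ae (hab : a < b) (hv : IntervalIntegrable v volume a b)
    (hy : ∀ t ∈ Icc a b, y t = c + ∫ s in a..t, v s) :
    derivWithin y (Icc a b) =ᵐ[intervalMeasure a b] v := by
  have h := hv.ae_hasDerivAt_integral
  rw [uIcc_of_le hab.le] at h
  filter_upwards [(ae_restrict_iff' measurableSet_Icc).2 h, MemSobolev.ae_mem] with t h1 ht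
  rw [derivWithin_congr hy (hy t ht)]
  exact ((h1 a (left_mem_Icc.2 hab.le)).const_add c).hasDerivWithinAt.derivWithin
    (uniqueDiffOn_Icc hab t ht)

/-- Extending `v` by its end values to a continuous function on the line yields the derivative at
every point, endpoints included. -/
theorem hasDerivWithinAt_primitive (hab : a < b) (hv : ContinuousOn v (Icc a b))
    (hy : ∀ t ∈ Icc a b, y t = c + ∫ s in a..t, v s) {t : ℝ} (ht : t ∈ Icc a b) :
    HasDerivWithinAt y (v t) (Icc a b) t := by
  have hc : Continuous (IccExtend hab.le ((Icc a b).domRestrict v)) :=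
    hv.domRestrict.Icc_extend'
  have he : ∀ s ∈ Icc a b, IccExtend hab.le ((Icc a b).domRestrict v) s = v s := fun s hs => by
    rw [IccExtend_of_mem _ _ hs]; rfl
  have hd := ((hc.integral_hasStrictDerivAt a t).hasDerivAt.const_add c).hasDerivWithinAt
    (s := Icc a b)
  rw [he t ht] at hd
  refine hd.congr_of_mem (fun s hs => ?_) ht
  rw [hy s hs]
  congr 1
  refine intervalIntegral.integral_congr fun σ hσ => ?_
  rw [uIcc_of_le hs.1] at hσ
  exact (he σ ⟨hσ.1, hσ.2.trans hs.2⟩).symm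

/-- Integration raises the order by one; this drives the bootstrap in `exists_solution_cauchy`. For
`k = 0` the derivative equals `v` only almost everywhere, for larger `k` everywhere by continuity.
-/
theorem MemSobolev.of_eq_add_integral (hp : 1 ≤ p) (hab : a < b) (hv : MemSobolev p a b k v)
    (hy : ∀ t ∈ Icc a b, y t = c + ∫ s in a..t, v s) : MemSobolev p a b (k + 1) y := by
  have hi := hv.intervalIntegrable hp hab
  cases k with
  | zero =>
    have hac : AbsolutelyContinuousOnInterval y a b := by
      have hconst : AbsolutelyContinuousOnInterval (fun _ : ℝ => c) a b :=
        ((contDiff_const (c := c)).contDiffOn (s := uIcc a b) (n := 1)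
          (𝕜 := ℝ)).absolutelyContinuousOnInterval
      exact MemSobolev.ac_congr hab
        (hconst.add (AbsolutelyContinuousOnInterval.integral_complex hi))
        fun t ht => (hy t ht).symm
    have hco := hac.continuousOn
    rw [uIcc_of_le hab.le] at hco
    refine ⟨contDiffOn_zero.2 hco, by simpa using hac, ?_⟩
    have h : MemLp (derivWithin y (Icc a b)) p (intervalMeasure a b) :=
      (memLp_congr_ae (derivWithin_primitive_ae hab hi hy)).2 hv
    simpa [iteratedDerivWithin_succ] using h
  | succ k =>
    have hd := fun t ht => hasDerivWithinAt_primitive hab (hv.continuousOn hab) hy (t := t) ht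
    refine (succ_succ_iff hab).2 ⟨fun t ht => (hd t ht).differentiableWithinAt,
      hv.congr hab fun t ht => ?_⟩
    exact ((hd t ht).derivWithin (uniqueDiffOn_Icc hab t ht)).symm

end Primitive

namespace MemSobolev

variable {p : ENNReal} {a b : ℝ} {k : ℕ} {y z : ℝ → ℂ}

/-- For `k ≥ 1` the space `W_p^k` is an algebra; for `k = 0` one factor has to be bounded. -/
theorem mul_of_continuousOn (hab : a < b) (hy : MemSobolev p a b k y) (hz : MemSobolev p a b k z)
    (hzc : ContinuousOn z (Icc a b)) : MemSobolev p a b k (y * z) := by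
  cases k with
  | zero =>
    have hz' : MemLp z ⊤ (intervalMeasure a b) := memLp_of_continuousOn hzc
    exact MemLp.mul (p := p) (q := ⊤) (r := p) hz' hy
  | succ k =>
    -- In each Leibniz term `y' z` and `z' y` the undifferentiated factor has one order more than
    -- the other, so `mul` applies and no induction is needed.
    have S := ((hy.deriv_succ hab).mul hab hz).add_smul hab ((hz.deriv_succ hab).mul hab hy) 1
    cases k with
    | zero =>
      have hyac := hy.absolutelyContinuousOnInterval hab
      have hzac := hz.absolutelyContinuousOnInterval hab
      refine ⟨contDiffOn_zero.2 ((hy.continuousOn hab).mul hzc), ?_, ?_⟩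
      · simpa using hyac.smul hzac
      · refine (memLp_congr_ae ?_).2 S
        filter_upwards [ae_mem, ae_diff hab hyac, ae_diff hab hzac] with t ht d d'
        rw [zero_add, iteratedDerivWithin_one, derivWithin_mul d d']
        simp; ring
    | succ k =>
      have hyd := ((succ_succ_iff hab).1 hy).1
      have hzd := ((succ_succ_iff hab).1 hz).1
      refine (succ_succ_iff hab).2 ⟨hyd.mul hzd, S.congr hab fun t ht => ?_⟩
      rw [derivWithin_mul (hyd t ht) (hzd t ht)]
      simp; ring

theorem sum {ι : Type*} (hab : a < b) {f : ι → ℝ → ℂ} (s : Finset ι)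
    (hf : ∀ i ∈ s, MemSobolev p a b k (f i)) : MemSobolev p a b k (∑ i ∈ s, f i) := by
  classical
  induction s using Finset.induction_on with
  | empty => simpa using zero
  | insert i s hi ih =>
    rw [Finset.sum_insert hi]
    simpa using (hf i (Finset.mem_insert_self i s)).add_smul hab
      (ih fun j hj => hf j (Finset.mem_insert_of_mem hj)) 1

end MemSobolev

/-! ### The Cauchy problem for functions, through the companion system. -/

section Companion

variable {p : ENNReal} {a b : ℝ} {m R n : ℕ}

/-- The coefficients of the first-order system for `(y, y', …, y^{(R)})`, when
`y^{(R + 1)} = -∑ A_s y^{(s)}`. -/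
def companion (A : Fin (R + 1) → Fin m → Fin m → ℝ → ℂ) (i j : Fin (R + 1) × Fin m) : ℝ → ℂ :=
  Fin.lastCases (motive := fun _ => ℝ → ℂ) (-A j.1 i.2 j.2)
    (fun q => if j = (q.succ, i.2) then 1 else 0) i.1

theorem sum_companion_last (A : Fin (R + 1) → Fin m → Fin m → ℝ → ℂ) (u : Fin m)
    (x : Fin (R + 1) × Fin m → ℝ → ℂ) (t : ℝ) :
    ∑ j, companion A (Fin.last R, u) j t * x j t = -∑ s, ∑ w, A s u w t * x (s, w) t := by
  simp [companion, Fintype.sum_prod_type]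

theorem sum_companion_castSucc (A : Fin (R + 1) → Fin m → Fin m → ℝ → ℂ) (q : Fin R) (u : Fin m)
    (x : Fin (R + 1) × Fin m → ℝ → ℂ) (t : ℝ) :
    ∑ j, companion A (q.castSucc, u) j t * x j t = x (q.succ, u) t := by
  rw [Finset.sum_eq_single (q.succ, u)]
  · simp [companion]
  · intro j _ hj
    simp [companion, hj]
  · simp

theorem intervalIntegrable_companion {A : Fin (R + 1) → Fin m → Fin m → ℝ → ℂ}
    (hA : ∀ s u w, IntervalIntegrable (A s u w) volume a b) (i j : Fin (R + 1) × Fin m) :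
    IntervalIntegrable (companion A i j) volume a b := by
  obtain ⟨s, u⟩ := i
  induction s using Fin.lastCases with
  | last => simpa [companion] using (hA j.1 u j.2).neg
  | cast q =>
    simp only [companion, Fin.lastCases_castSucc]
    split_ifs
    · exact intervalIntegrable_const (c := (1 : ℂ))
    · exact intervalIntegrable_const (c := (0 : ℂ))

/-- The Volterra system yields continuous components `x (s, u)`, playing the role of `y_u^{(s)}`.
Each one is the primitive of the next, and the last is the primitive of `f - ∑ A x`; feeding this
back raises their regularity step by step. -/
theorem exists_solution_cauchy (hp : 1 ≤ p) (hab : a < b)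
    {A : Fin (R + 1) → Fin m → Fin m → ℝ → ℂ} (hA : ∀ s u w, MemSobolev p a b n (A s u w))
    {f : Fin m → ℝ → ℂ} (hf : ∀ u, MemSobolev p a b n (f u)) (c : Fin (R + 1) → Fin m → ℂ) :
    ∃ y : Fin m → ℝ → ℂ, (∀ u, MemSobolev p a b (n + (R + 1)) (y u)) ∧
      (∀ s u, iteratedDerivWithin s.1 (y u) (Icc a b) a = c s u) ∧
      ∀ u, iteratedDerivWithin (R + 1) (y u) (Icc a b) =ᵐ[intervalMeasure a b]
        fun t => f u t - ∑ s, ∑ w, A s u w t * iteratedDerivWithin s.1 (y w) (Icc a b) t := by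
  have hAi := fun s u w => (hA s u w).intervalIntegrable hp hab
  have hfi := fun u => (hf u).intervalIntegrable hp hab
  have hK := intervalIntegrable_companion hAi
  -- The free term holds the initial values; the right-hand side `f` enters only the equation of the
  -- highest component.
  have hh : ∀ i : Fin (R + 1) × Fin m, ContinuousOn (fun t => c i.1 i.2 +
      if i.1 = Fin.last R then ∫ s in a..t, f i.2 s else 0) (Icc a b) := by
    intro i
    refine continuousOn_const.add ?_
    split_ifs
    · have := intervalIntegral.continuousOn_primitive_interval' (hfi i.2) left_mem_uIcc
      rwa [uIcc_of_le hab.le] at this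
    · exact continuousOn_const
  obtain ⟨x, hxc, hx⟩ := exists_volterra_solution hab hK hh
  have hcast : ∀ (q : Fin R) (u : Fin m), ∀ t ∈ Icc a b,
      x (q.castSucc, u) t = c q.castSucc u + ∫ s in a..t, x (q.succ, u) s := by
    intro q u t ht
    have := hx (q.castSucc, u) t ht
    simpa only [sum_companion_castSucc, (Fin.castSucc_lt_last q).ne, if_false, add_zero] using this
  -- This is the future `y_u^{(R+1)}`.
  set v : Fin m → ℝ → ℂ := fun u => f u + (-1 : ℂ) • ∑ s, ∑ w, A s u w * x (s, w) with hv
  have hvs : ∀ u t, v u t = f u t + -∑ s, ∑ w, A s u w t * x (s, w) t := by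
    intro u t
    simp [hv]
  have hlast : ∀ u, ∀ t ∈ Icc a b,
      x (Fin.last R, u) t = c (Fin.last R) u + ∫ s in a..t, v u s := by
    intro u t ht
    have hs : uIcc a t ⊆ uIcc a b :=
      uIcc_subset_uIcc left_mem_uIcc (by rwa [uIcc_of_le hab.le])
    have hi := intervalIntegrable_sum_mul hab hK hxc (Fin.last R, u)
    have := hx (Fin.last R, u) t ht
    simp only [sum_companion_last, if_true] at this hi
    rw [this, add_assoc, ← intervalIntegral.integral_add ((hfi u).mono_set hs) (hi.mono_set hs)]
    simp only [hvs]
  -- The order of `v` is capped at `n` by `A` and `f`. Continuity of `x` is what makes the product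
  -- legitimate at order 0, where `A` is only in `L_p`.
  have hvm : ∀ q : ℕ, (∀ i, MemSobolev p a b (min q n) (x i)) →
      ∀ u, MemSobolev p a b (min q n) (v u) := by
    intro q hq u
    refine ((hf u).mono hab (min_le_right _ _)).add_smul hab ?_ _
    refine MemSobolev.sum hab _ fun s _ => MemSobolev.sum hab _ fun w _ => ?_
    exact ((hA s u w).mono hab (min_le_right _ _)).mul_of_continuousOn hab (hq _) (hxc _)
  -- Bootstrap: each round gains one order, until component `s` reaches its natural order `n + (R +
  -- 1) - s`. Round 0 only says that continuous functions are in `L_p`.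
  have hreg : ∀ (q : ℕ) (i : Fin (R + 1) × Fin m),
      MemSobolev p a b (min q (n + (R + 1) - i.1)) (x i) := by
    intro q
    induction q with
    | zero =>
      intro i
      rw [Nat.zero_min]
      exact MemSobolev.memLp_of_continuousOn (hxc i)
    | succ q ih =>
      rintro ⟨s, u⟩
      induction s using Fin.lastCases with
      | last =>
        have h1 := hvm q (fun i => (ih i).mono hab (by have := i.1.2; omega)) u
        have h2 := h1.of_eq_add_integral hp hab (hlast u)
        refine h2.mono hab ?_
        simp only [Fin.val_last]
        omega
      | cast i =>
        have h2 := (ih (i.succ, u)).of_eq_add_integral hp hab (hcast i u)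
        refine h2.mono hab ?_
        have := i.2
        simp only [Fin.val_succ, Fin.val_castSucc]
        omega
  have hder : ∀ (s : Fin (R + 1)) (u : Fin m),
      EqOn (iteratedDerivWithin s.1 (x (0, u)) (Icc a b)) (x (s, u)) (Icc a b) := by
    intro s u
    induction s using Fin.induction with
    | zero => intro t _; simp
    | succ i ih =>
      intro t ht
      rw [Fin.val_succ, iteratedDerivWithin_succ]
      simp only [Fin.val_castSucc] at ih
      rw [derivWithin_congr ih (ih ht)]
      exact (hasDerivWithinAt_primitive hab (hxc _) (hcast i u) ht).derivWithin
        (uniqueDiffOn_Icc hab t ht)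
  have ha : a ∈ Icc a b := left_mem_Icc.2 hab.le
  refine ⟨fun u => x (0, u), fun u => ?_, fun s u => ?_, fun u => ?_⟩
  -- After `n + (R + 1)` rounds the component `s = 0` has attained its cap.
  · simpa using hreg (n + (R + 1)) (0, u)
  · rw [hder s u ha]
    induction s using Fin.lastCases with
    | last => simpa using hlast u a ha
    | cast i => simpa using hcast i u a ha
  · have hvi := (hvm 0 (fun i => by
      rw [Nat.zero_min]; exact MemSobolev.memLp_of_continuousOn (hxc i)) u).intervalIntegrable hp hab
    filter_upwards [MemSobolev.ae_mem, derivWithin_primitive_ae hab hvi (hlast u)] with t ht h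
    have h1 := hder (Fin.last R) u
    rw [Fin.val_last] at h1
    rw [iteratedDerivWithin_succ, derivWithin_congr h1 (h1 ht), h, hvs, sub_eq_add_neg]
    simp only [hder _ _ ht]

/-- The derivatives of `y` up to order `R` are absolutely continuous, so they are the integrals of
their derivatives and solve the Volterra system with zero free term, as does the zero function.
Coefficients in `L_p` suffice. -/
theorem solution_cauchy_eq_zero (hp : 1 ≤ p) (hab : a < b)
    {A : Fin (R + 1) → Fin m → Fin m → ℝ → ℂ} (hA : ∀ s u w, MemSobolev p a b 0 (A s u w))
    {y : Fin m → ℝ → ℂ} (hy : ∀ u, MemSobolev p a b (R + 1) (y u))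
    (hya : ∀ (s : Fin (R + 1)) u, iteratedDerivWithin s.1 (y u) (Icc a b) a = 0)
    (hye : ∀ u, iteratedDerivWithin (R + 1) (y u) (Icc a b) =ᵐ[intervalMeasure a b]
        fun t => -∑ s : Fin (R + 1), ∑ w,
          A s u w t * iteratedDerivWithin s.1 (y w) (Icc a b) t) (u : Fin m) :
    EqOn (y u) 0 (Icc a b) := by
  have hK := intervalIntegrable_companion fun s u w => (hA s u w).intervalIntegrable hp hab
  set x : Fin (R + 1) × Fin m → ℝ → ℂ := fun i => iteratedDerivWithin i.1.1 (y i.2) (Icc a b)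
    with hx
  have hxm : ∀ i, MemSobolev p a b 1 (x i) := fun i =>
    (hy i.2).iteratedDeriv hab (by have := i.1.2; omega)
  have h := volterra_solution_unique hab hK (x := x) (y := 0) (h := 0)
    (fun i => (hxm i).continuousOn hab) (fun i => continuousOn_const) (fun i => continuousOn_const)
    (by
      rintro ⟨s, u⟩ t ht
      have hxa : x (s, u) a = 0 := hya s u
      have hd : derivWithin (x (s, u)) (Icc a b) =ᵐ[intervalMeasure a b]
          fun t => ∑ j, companion A (s, u) j t * x j t := by
        simp only [hx, ← iteratedDerivWithin_succ]
        induction s using Fin.lastCases with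
        | last =>
          simp only [sum_companion_last, Fin.val_last]
          exact hye u
        | cast i =>
          simp only [sum_companion_castSucc]
          exact EventuallyEq.rfl
      have := (hxm (s, u)).eq_add_integral hp hab hd ht
      rwa [hxa] at this)
    (by simp) (0, u)
  simpa [hx] using h

end Companion

/-! ### Kernel and cokernel of a pair of linear maps, the first being surjective for the cokernel.
-/

section LinearAlgebra

variable {𝕜 X Z V W : Type} [Field 𝕜] [AddCommGroup X] [Module 𝕜 X] [AddCommGroup Z]
  [Module 𝕜 Z] [AddCommGroup V] [Module 𝕜 V] [AddCommGroup W] [Module 𝕜 W]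
  {L : X →ₗ[𝕜] Z} {Φ : V →ₗ[𝕜] X}

/-- `Φ` carries `ker (B ∘ Φ)` isomorphically onto `ker L ∩ ker B`. -/
theorem rank_ker_prod_eq (hΦ : Function.Injective Φ) (hker : LinearMap.range Φ = LinearMap.ker L)
    (B : X →ₗ[𝕜] W) :
    Module.rank 𝕜 (LinearMap.ker (L.prod B)) = Module.rank 𝕜 (LinearMap.ker (B ∘ₗ Φ)) := by
  have h : LinearMap.ker (L.prod B) = (LinearMap.ker (B ∘ₗ Φ)).map Φ := by
    rw [LinearMap.ker_prod, LinearMap.ker_comp, Submodule.map_comap_eq, hker]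
  rw [h]
  exact (Submodule.equivMapOfInjective Φ hΦ _).symm.rank_eq

/-- The map sending w to the class of `(0, w)` is onto because `L` is, and its kernel is `B(ker L)`,
the range of `B ∘ Φ`. -/
theorem rank_coker_prod_eq (hL : Function.Surjective L)
    (hker : LinearMap.range Φ = LinearMap.ker L) (B : X →ₗ[𝕜] W) :
    Module.rank 𝕜 ((Z × W) ⧸ LinearMap.range (L.prod B)) =
      Module.rank 𝕜 (W ⧸ LinearMap.range (B ∘ₗ Φ)) := by
  let Q : W →ₗ[𝕜] (Z × W) ⧸ LinearMap.range (L.prod B) :=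
    (LinearMap.range (L.prod B)).mkQ ∘ₗ LinearMap.inr 𝕜 Z W
  have hQ : Function.Surjective Q := by
    intro q
    obtain ⟨⟨z, w⟩, rfl⟩ := Submodule.Quotient.mk_surjective _ q
    obtain ⟨x, rfl⟩ := hL z
    -- Subtracting `(L x, B x)` from `(L x, w)` leaves `(0, w - B x)` in the same class.
    refine ⟨w - B x, (Submodule.Quotient.eq _).2 ⟨-x, ?_⟩⟩
    simp
  have hQk : LinearMap.ker Q = LinearMap.range (B ∘ₗ Φ) := by
    ext w
    rw [LinearMap.mem_ker]
    simp only [Q, LinearMap.comp_apply, Submodule.mkQ_apply, Submodule.Quotient.mk_eq_zero,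
      LinearMap.mem_range, LinearMap.inr_apply]
    constructor
    · rintro ⟨x, hxw⟩
      obtain ⟨hx, rfl⟩ := Prod.mk.inj hxw
      obtain ⟨d, rfl⟩ : x ∈ LinearMap.range Φ := hker ▸ hx
      exact ⟨d, rfl⟩
    · rintro ⟨d, rfl⟩
      exact ⟨Φ d, Prod.ext (hker ▸ LinearMap.mem_range_self Φ d : Φ d ∈ LinearMap.ker L) rfl⟩
  rw [← hQk]
  exact (Q.quotKerEquivOfSurjective hQ).symm.rank_eq

end LinearAlgebra

/-! ### From representatives to Sobolev classes. -/

section SobolevRepresentatives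

variable {p : ENNReal} {a b : ℝ} [hab : Fact (a < b)] {k : ℕ}

namespace Sobolev

theorem rep_zero : (0 : Sobolev p a b k).rep =ᵐ[intervalMeasure a b] 0 := by
  refine (toLp_ae _).symm.trans ?_
  rw [map_zero]
  exact Lp.coeFn_zero _ _ _

theorem rep_sum {ι : Type*} (s : Finset ι) (f : ι → Sobolev p a b k) :
    (∑ i ∈ s, f i).rep =ᵐ[intervalMeasure a b] fun t => ∑ i ∈ s, (f i).rep t := by
  classical
  induction s using Finset.induction_on with
  | empty => exact rep_zero
  | insert i s hi ih =>
    rw [Finset.sum_insert hi]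
    filter_upwards [rep_add (f i) (∑ i ∈ s, f i), ih] with t h1 h2
    rw [h1, Finset.sum_insert hi, ← h2]
    simp

/-- Two continuous functions equal almost everywhere on `[a, b]` agree there. This gives pointwise
values, in particular at `a`, a meaning independent of the chosen representative. -/
theorem rep_eqOn {f : Sobolev p a b (k + 1)} {y : ℝ → ℂ} (hy : ContinuousOn y (Icc a b))
    (h : f.rep =ᵐ[intervalMeasure a b] y) : EqOn f.rep y (Icc a b) :=
  Measure.eqOn_Icc_of_ae_eq volume hab.out.ne h (f.rep_mem.continuousOn hab.out) hy

/-- Reduces point values to the linear operator `deriv` with values in `W_p^1`, whose elements are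
continuous; linearity of `derivAtLinear` follows from this. -/
theorem derivAt_eq_rep_deriv (f : Sobolev p a b k) {j : ℕ} (hj : j < k) {t : ℝ}
    (ht : t ∈ Icc a b) : f.derivAt j t = (deriv 1 j (by omega) f).rep t :=
  have h := f.rep_mem.iteratedDeriv hab.out (i := 1) (j := j) (by omega)
  (rep_eqOn (k := 0) (h.continuousOn hab.out) (rep_ofFun _ h) ht).symm

/-- The value `y^{(j)}(t)` as a linear functional on `W_p^k`, where `j < k`. -/
noncomputable def derivAtLinear (j : ℕ) (hj : j < k) {t : ℝ} (ht : t ∈ Icc a b) :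
    Sobolev p a b k →ₗ[ℂ] ℂ where
  toFun f := f.derivAt j t
  map_add' f g := by
    rw [derivAt_eq_rep_deriv _ hj ht, derivAt_eq_rep_deriv _ hj ht, derivAt_eq_rep_deriv _ hj ht,
      map_add, rep_eqOn (k := 0) (((rep_mem _).continuousOn hab.out).add
        (((rep_mem _).continuousOn hab.out).const_smul (1 : ℂ))) (rep_add _ _) ht]
    simp
  map_smul' c f := by
    rw [derivAt_eq_rep_deriv _ hj ht, derivAt_eq_rep_deriv _ hj ht,
      map_smul, rep_eqOn (k := 0) ((continuousOn_const (c := (0 : ℂ))).add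
        (((rep_mem _).continuousOn hab.out).const_smul c)) (rep_smul _ _) ht]
    simp

theorem derivAt_ofFun {y : ℝ → ℂ} (hy : MemSobolev p a b k y) {j : ℕ} (hj : j < k) {t : ℝ}
    (ht : t ∈ Icc a b) : (ofFun y hy).derivAt j t = iteratedDerivWithin j y (Icc a b) t := by
  obtain ⟨k, rfl⟩ : ∃ k', k = k' + 1 := ⟨k - 1, by omega⟩
  exact iteratedDerivWithin_congr (rep_eqOn (hy.continuousOn hab.out) (rep_ofFun y hy)) ht

end Sobolev

variable {n m r : ℕ}

theorem rep_diffOp (A : Fin r → Matrix (Fin m) (Fin m) (Sobolev p a b n))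
    (y : Fin m → Sobolev p a b (n + r)) (u : Fin m) :
    (diffOp A y u).rep =ᵐ[intervalMeasure a b] fun t =>
      iteratedDerivWithin r (y u).rep (Icc a b) t +
        ∑ s, ∑ w, (A s u w).rep t * iteratedDerivWithin s.1 (y w).rep (Icc a b) t := by
  have h0 : diffOp A y u = Sobolev.deriv n r le_rfl (y u) +
      ∑ s : Fin r, ∑ w, Sobolev.mulLeft (A s u w) (Sobolev.deriv (n + 1) s.1 (by omega) (y w)) := by
    simp [diffOp]
  have h1 : ∀ s : Fin r, ∀ w,
      (Sobolev.mulLeft (A s u w) (Sobolev.deriv (n + 1) s.1 (by omega) (y w))).rep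
        =ᵐ[intervalMeasure a b]
      fun t => (A s u w).rep t * iteratedDerivWithin s.1 (y w).rep (Icc a b) t := by
    intro s w
    have e1 := Sobolev.rep_ofFun _ ((A s u w).rep_mem.mul hab.out
      (Sobolev.deriv (n + 1) s.1 (by omega) (y w)).rep_mem)
    have e2 := Sobolev.rep_ofFun _
      ((y w).rep_mem.iteratedDeriv hab.out (i := n + 1) (j := s.1) (by omega))
    filter_upwards [e1, e2] with t e1 e2
    refine e1.trans ?_
    rw [Pi.mul_apply]
    exact congrArg _ e2
  have h1' := eventually_all.2 fun s => eventually_all.2 (h1 s)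
  have h2 := eventually_all.2 fun s : Fin r => Sobolev.rep_sum Finset.univ fun w =>
    Sobolev.mulLeft (A s u w) (Sobolev.deriv (n + 1) s.1 (by omega) (y w))
  have h3 := Sobolev.rep_sum Finset.univ fun s : Fin r => ∑ w,
    Sobolev.mulLeft (A s u w) (Sobolev.deriv (n + 1) s.1 (by omega) (y w))
  have h4 := Sobolev.rep_ofFun _ ((y u).rep_mem.iteratedDeriv hab.out (i := n) (j := r) le_rfl)
  have h5 := Sobolev.rep_add (Sobolev.deriv n r le_rfl (y u)) (∑ s : Fin r, ∑ w,
    Sobolev.mulLeft (A s u w) (Sobolev.deriv (n + 1) s.1 (by omega) (y w)))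
  rw [h0]
  filter_upwards [h1', h2, h3, h4, h5] with t h1 h2 h3 h4 h5
  rw [h5, Pi.add_apply, Pi.smul_apply, one_smul, h3]
  congr 1
  exact Finset.sum_congr rfl fun s _ => (h2 s).trans (Finset.sum_congr rfl fun w _ => h1 s w)

/-- Used twice: arbitrary `f` with zero data gives surjectivity of `L`, and `f = 0` with unit data
gives the columns of the `Y_i`. -/
theorem exists_diffOp_eq (hp : 1 ≤ p) (A : Fin r → Matrix (Fin m) (Fin m) (Sobolev p a b n))
    (f : Fin m → Sobolev p a b n) (c : Fin r → Fin m → ℂ) :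
    ∃ y : Fin m → Sobolev p a b (n + r), diffOp A y = f ∧
      ∀ (s : Fin r) u, (y u).derivAt s.1 a = c s u := by
  cases r with
  | zero =>
    -- For `r = 0` the operator is the identity and there are no initial values; the companion
    -- system needs at least one component.
    refine ⟨f, ?_, fun s => s.elim0⟩
    ext1 u
    refine Sobolev.ext_rep ((rep_diffOp A _ u).trans ?_)
    simp
  | succ R =>
    obtain ⟨y, hy, hya, hye⟩ := exists_solution_cauchy hp hab.out
      (A := fun s u w => (A s u w).rep) (fun s u w => (A s u w).rep_mem)
      (f := fun u => (f u).rep) (fun u => (f u).rep_mem) c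
    have ha : a ∈ Icc a b := left_mem_Icc.2 hab.out.le
    refine ⟨fun u => Sobolev.ofFun (y u) (hy u), ?_, fun s u => ?_⟩
    · ext1 u
      refine Sobolev.ext_rep ((rep_diffOp A _ u).trans ?_)
      have hd := fun u (s : ℕ) (hs : s ≤ R + 1) =>
        MemSobolev.iteratedDeriv_congr_ae hab.out (Sobolev.rep_mem _) (hy u)
          (Sobolev.rep_ofFun (y u) (hy u)) (j := s) (by omega)
      have hd' := eventually_all.2 fun w => eventually_all.2 fun s : Fin (R + 1) =>
        hd w s.1 s.2.le
      filter_upwards [hye u, hd u (R + 1) le_rfl, hd'] with t h1 h2 h3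
      rw [h2, h1]
      simp only [h3, sub_add_cancel]
    · rw [Sobolev.derivAt_ofFun (hy u) (by omega) ha, hya]

theorem eq_zero_of_diffOp_eq_zero (hp : 1 ≤ p)
    (A : Fin r → Matrix (Fin m) (Fin m) (Sobolev p a b n))
    {y : Fin m → Sobolev p a b (n + r)} (hy : diffOp A y = 0)
    (hya : ∀ (s : Fin r) u, (y u).derivAt s.1 a = 0) : y = 0 := by
  have hL : ∀ u, (fun t => iteratedDerivWithin r (y u).rep (Icc a b) t +
        ∑ s, ∑ w, (A s u w).rep t * iteratedDerivWithin s.1 (y w).rep (Icc a b) t)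
      =ᵐ[intervalMeasure a b] 0 := by
    intro u
    refine (rep_diffOp A y u).symm.trans ?_
    rw [hy]
    exact Sobolev.rep_zero
  ext1 u
  refine Sobolev.ext_rep (EventuallyEq.trans ?_ Sobolev.rep_zero.symm)
  cases r with
  | zero => simpa using hL u
  | succ R =>
    refine MemSobolev.ae_of_eqOn (solution_cauchy_eq_zero hp hab.out
      (A := fun s u w => (A s u w).rep) (y := fun u => (y u).rep)
      (fun s u w => (A s u w).rep_mem.mono hab.out (Nat.zero_le n))
      (fun u => (y u).rep_mem.mono hab.out (by omega)) hya (fun u => ?_) u)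
    filter_upwards [hL u] with t h
    exact eq_neg_of_add_eq_zero_left h

end SobolevRepresentatives

/-! ### Fundamental solutions and the characteristic matrix. -/

section Cauchy

variable {p : ENNReal} {a b : ℝ} [hab : Fact (a < b)] {n m r l : ℕ}

/-- The initial values `y^{(s)}(a)`, `s < r`. -/
noncomputable def initialData : (Fin m → Sobolev p a b (n + r)) →ₗ[ℂ] (Fin r × Fin m → ℂ) :=
  LinearMap.pi fun i => Sobolev.derivAtLinear i.1.1 (by omega) (left_mem_Icc.2 hab.out.le) ∘ₗ
    LinearMap.proj i.2

theorem initialData_apply (y : Fin m → Sobolev p a b (n + r)) (i : Fin r × Fin m) :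
    initialData y i = (y i.2).derivAt i.1.1 a := rfl

theorem eq_of_diffOp_eq (hp : 1 ≤ p) {A : Fin r → Matrix (Fin m) (Fin m) (Sobolev p a b n)}
    {y z : Fin m → Sobolev p a b (n + r)} (h : diffOp A y = diffOp A z)
    (hi : initialData y = initialData z) : y = z := by
  rw [← sub_eq_zero]
  refine eq_zero_of_diffOp_eq_zero hp A (by rw [map_sub, h, sub_self]) fun s u => ?_
  rw [← initialData_apply (y - z) (s, u), map_sub, hi, sub_self]
  rfl

/-- The block condition `δ_{ij} I_m`, read by columns, turns the initial data into the standard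
basis vectors of `ℂ^{rm}`. -/
theorem isCauchySolution_iff {A : Fin r → Matrix (Fin m) (Fin m) (Sobolev p a b n)} {i : Fin r}
    {Y : Matrix (Fin m) (Fin m) (Sobolev p a b (n + r))} :
    IsCauchySolution A i Y ↔ ∀ v, diffOp A (fun u => Y u v) = 0 ∧
      initialData (fun u => Y u v) = Pi.single (i, v) 1 := by
  have h : ∀ (j : Fin r) (u v : Fin m), (if i = j then (1 : Matrix (Fin m) (Fin m) ℂ) else 0) u v =
      (Pi.single (i, v) 1 : Fin r × Fin m → ℂ) (j, u) := by
    intro j u v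
    by_cases h1 : i = j <;> by_cases h2 : u = v <;>
      simp [h1, h2, Matrix.one_apply, eq_comm]
  rw [IsCauchySolution, forall_and]
  refine and_congr_right fun _ => ⟨fun H v => ?_, fun H j => ?_⟩
  · ext ⟨j, u⟩
    rw [← h, ← H j]
    rfl
  · ext u v
    rw [h, ← H v]
    rfl

theorem existsUnique_isCauchySolution (hp : 1 ≤ p)
    (A : Fin r → Matrix (Fin m) (Fin m) (Sobolev p a b n)) (i : Fin r) :
    ∃! Y, IsCauchySolution A i Y := by
  choose y hy hya using fun v : Fin m =>
    exists_diffOp_eq hp A 0 fun s u => (Pi.single (i, v) 1 : Fin r × Fin m → ℂ) (s, u)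
  have hsol : IsCauchySolution A i (Matrix.of fun u v => y v u) :=
    isCauchySolution_iff.2 fun v => ⟨hy v, funext fun j => hya v j.1 j.2⟩
  refine ⟨_, hsol, fun Z hZ => ?_⟩
  have h1 := isCauchySolution_iff.1 hsol
  have h2 := isCauchySolution_iff.1 hZ
  ext1 u v
  exact congrFun (eq_of_diffOp_eq hp ((h2 v).1.trans (h1 v).1.symm)
    ((h2 v).2.trans (h1 v).2.symm)) u

/-- The solution `∑ Y_i d_i` of the homogeneous equation. -/
noncomputable def fundamentalMap (Y : Fin r → Matrix (Fin m) (Fin m) (Sobolev p a b (n + r))) :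
    (Fin r × Fin m → ℂ) →ₗ[ℂ] (Fin m → Sobolev p a b (n + r)) :=
  Fintype.linearCombination ℂ fun i u => Y i.1 u i.2

variable {A : Fin r → Matrix (Fin m) (Fin m) (Sobolev p a b n)}
  {Y : Fin r → Matrix (Fin m) (Fin m) (Sobolev p a b (n + r))}

theorem diffOp_fundamentalMap (hY : ∀ i, IsCauchySolution A i (Y i)) (d : Fin r × Fin m → ℂ) :
    diffOp A (fundamentalMap Y d) = 0 := by
  rw [fundamentalMap, Fintype.linearCombination_apply, map_sum]
  refine Finset.sum_eq_zero fun i _ => ?_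
  rw [map_smul, (isCauchySolution_iff.1 (hY i.1) i.2).1, smul_zero]

/-- The columns have the standard basis as initial data. So `fundamentalMap` has a left inverse,
whence its injectivity. -/
theorem initialData_fundamentalMap (hY : ∀ i, IsCauchySolution A i (Y i))
    (d : Fin r × Fin m → ℂ) : initialData (fundamentalMap Y d) = d := by
  rw [fundamentalMap, Fintype.linearCombination_apply, map_sum]
  simp only [map_smul, (isCauchySolution_iff.1 (hY _) _).2]
  ext j
  simp [Pi.single_apply]

/-- A homogeneous solution coincides with the combination whose coefficients are its own initial
data, by uniqueness. -/
theorem range_fundamentalMap (hp : 1 ≤ p) (hY : ∀ i, IsCauchySolution A i (Y i)) :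
    LinearMap.range (fundamentalMap Y) = LinearMap.ker (diffOp A) := by
  ext y
  refine ⟨?_, fun hy => ⟨initialData y, ?_⟩⟩
  · rintro ⟨d, rfl⟩
    exact diffOp_fundamentalMap hY d
  · exact eq_of_diffOp_eq hp ((diffOp_fundamentalMap hY _).trans hy.symm)
      (initialData_fundamentalMap hY _)

theorem mulVecLin_charMatrix [Fact (1 ≤ p)]
    (B : (Fin m → Sobolev p a b (n + r)) →L[ℂ] (Fin l → ℂ)) :
    (charMatrix B Y).mulVecLin = B.toLinearMap ∘ₗ fundamentalMap Y := by
  ext1 i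
  ext c
  simp [fundamentalMap, charMatrix]

end Cauchy

theorem theorem2 {p : ENNReal} [Fact (1 ≤ p)] {a b : ℝ} [Fact (a < b)] {n m r l : ℕ}
    (A : Fin r → Matrix (Fin m) (Fin m) (Sobolev p a b n))
    (B : (Fin m → Sobolev p a b (n + r)) →L[ℂ] (Fin l → ℂ)) :
    (∀ i, ∃! Y, IsCauchySolution A i Y) ∧
    ∀ Y : Fin r → Matrix (Fin m) (Fin m) (Sobolev p a b (n + r)),
      (∀ i, IsCauchySolution A i (Y i)) →
        Module.rank ℂ (LinearMap.ker (bvpOp A B)) =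
          Module.rank ℂ (LinearMap.ker (charMatrix B Y).mulVecLin) ∧
        Module.rank ℂ (((Fin m → Sobolev p a b n) × (Fin l → ℂ)) ⧸
            LinearMap.range (bvpOp A B)) =
          Module.rank ℂ ((Fin l → ℂ) ⧸ LinearMap.range (charMatrix B Y).mulVecLin) := by
  have hp : 1 ≤ p := Fact.out
  refine ⟨existsUnique_isCauchySolution hp A, fun Y hY => ?_⟩
  have hr := range_fundamentalMap hp hY
  have hinj : Function.Injective (fundamentalMap Y) :=
    Function.LeftInverse.injective (initialData_fundamentalMap hY)
  have hsurj : Function.Surjective (diffOp A) := fun f =>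
    (exists_diffOp_eq hp A f 0).imp fun _ h => h.1
  -- Once `M(L,B)` is written as `B ∘ Φ`, both equalities are the algebraic lemmas, `bvpOp A B`
  -- being the pair `(L, B)` by definition.
  rw [mulVecLin_charMatrix B]
  exact ⟨rank_ker_prod_eq hinj hr _, rank_coker_prod_eq hsurj hr _⟩
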